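/- For $n\ge 0$ let $B_n$ be the set of signed permutations of order $n$, i.e. words $w=x_1x_2\cdots x_n$ with $x_i\in\{\pm1,\dots,\pm n\}$ such that $|x_1||x_2|\cdots|x_n|$ is a permutation of $12\cdots n$. Let $\operatorname{neg} w$ be the number of negative letters of $w$, let $\operatorname{maj} w=\sum_{i=1}^{n-1} i\,\chi(x_i>x_{i+1})$ (where $\chi(A)=1$ if $A$ holds and $0$ otherwise) and $\operatorname{fmaj} w=2\operatorname{maj} w+\operatorname{neg} w$. Let $D_n^B=\{w\in B_n: x_i\ne i \text{ for all } i\}$ be the set of signed derangements, and $$D_n^B(q,Z)=\sum_{w\in D_n^B}q^{\operatorname{fmaj} w}Z^{\operatorname{neg} w}\in\mathbb Z[q,Z].$$ Write $(a;p)_n=\prod_{k=0}^{n-1}(1-ap^k)$, $(a;p)_\infty=\prod_{k\ge0}(1-ap^k)$ and ${n\brack k}_p=\frac{(p;p)_n}{(p;p)_k(p;p)_{n-k}}$. The infinite product $(u;q^2)_\infty$ converges (coefficientwise) in the ring $\mathbb Z[[q,Z]][[u]]$ of formal power series, in which the following identity holds: $$\sum_{n\ge0}\frac{u^n}{(q^2;q^2)_n}D_n^B(q,Z)=\Bigl(1-u\,\frac{1+qZ}{1-q^2}\Bigr)^{-1}(u;q^2)_\infty.\tag{6.6}$$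 Moreover the following hold: $$\frac{(q^2;q^2)_n}{(1-q^2)^n}(1+qZ)^n=\sum_{k=0}^n{n\brack k}_{q^2}D_k^B(q,Z)\qquad(n\ge0);\tag{6.7}$$ $$D_n^B(q,Z)=\sum_{k=0}^n{n\brack k}_{q^2}(-1)^kq^{k(k-1)}\frac{(q^2;q^2)_{n-k}}{(1-q^2)^{n-k}}(1+qZ)^{n-k}\qquad(n\ge0);\tag{6.8}$$ $$D_0^B(q,Z)=1,\qquad D_{n+1}^B(q,Z)=(1+qZ)\frac{1-q^{2n+2}}{1-q^2}D_n^B(q,Z)+(-1)^{n+1}q^{n(n+1)}\qquad(n\ge0);\tag{6.9}$$ and $D_0^B(q,Z)=1$, $D_1^B(q,Z)=Zq$, $$D_{n+1}^B(q,Z)=\Bigl(\frac{1-q^{2n}}{1-q^2}+qZ\,\frac{1-q^{2n+2}}{1-q^2}\Bigr)D_n^B(q,Z)+(1+qZ)q^{2n}\,\frac{1-q^{2n}}{1-q^2}D_{n-1}^B(q,Z)\qquad(n\ge1).\tag{6.10}$$ These are equivalent forms of one another: for every sequence $(a_n)_{n\ge0}$ in $\mathbb Z[[q,Z]]$, the five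 conditions obtained from (6.6), (6.7), (6.8), (6.9) and (6.10) by replacing $D_n^B(q,Z)$ by $a_n$ throughout are equivalent. -/

import Mathlib

open scoped MvPowerSeries.WithPiTopology PowerSeries.WithPiTopology

namespace SignedDerangement

/-! ### Signed permutations and their statistics -/

/-- Signed permutations of order `n`: a permutation `σ` of the `n` positions together with a sign
`ε i = ±1` for each position.  It stands for the word `x₁ x₂ ⋯ xₙ` with `x_{i+1} = ε i * (σ i + 1)`,
where `i : Fin n` counts positions from `0`; see `letter`. -/
abbrev SignedPerm (n : ℕ) : Type := Equiv.Perm (Fin n) × (Fin n → ℤˣ)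

variable {n : ℕ}

/-- The letter of the word `w` at position `i` (positions counted from `0`). -/
def letter (w : SignedPerm n) (i : Fin n) : ℤ := (w.2 i : ℤ) * ((w.1 i : ℕ) + 1 : ℤ)

/-- The number of negative letters. -/
def neg (w : SignedPerm n) : ℕ := (Finset.univ.filter fun i : Fin n => letter w i < 0).card

/-- The major index: the sum of the `i ∈ {1, …, n - 1}` with `x_i > x_{i+1}`
(in the code, `i : Fin n` stands for the position `i + 1`). -/
def maj (w : SignedPerm n) : ℕ :=
  ∑ i : Fin n, if h : (i : ℕ) + 1 < n then
    (if letter w i > letter w ⟨(i : ℕ) + 1, h⟩ then (i : ℕ) + 1 else 0) else 0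

/-- The flag-major index. -/
def fmaj (w : SignedPerm n) : ℕ := 2 * maj w + neg w

/-- The set of positions (counted from `0`) of the positive fixed points. -/
def fixPos (w : SignedPerm n) : Finset (Fin n) :=
  Finset.univ.filter fun i : Fin n => letter w i = (i : ℕ) + 1

/-- The set of signed derangements of order `n`: signed permutations without positive
fixed points (negative fixed points `x_i = -i` are allowed). -/
def signedDerangements (n : ℕ) : Finset (SignedPerm n) :=
  Finset.univ.filter fun w => fixPos w = ∅

/-- The polynomial `D_n^B(q, Z) ∈ ℤ[q, Z]`; the variable `0` is `q`, the variable `1` is `Z`. -/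
noncomputable def derangementPoly (n : ℕ) : MvPolynomial (Fin 2) ℤ :=
  ∑ w ∈ signedDerangements n, MvPolynomial.X 0 ^ fmaj w * MvPolynomial.X 1 ^ neg w

/-! ### Formal setting

Coefficients live in the ring `ℤ⟦q, Z⟧`, which contains `ℤ[q, Z]` and in which `1 - q ^ (2 * j)`,
`j ≥ 1`, is invertible; generating functions are formal power series in `u` over that ring.
`ℤ` is discrete and the power series rings have the topology of coefficientwise convergence. -/

/-- The coefficient ring `ℤ⟦q, Z⟧`. -/
abbrev Coeff : Type := MvPowerSeries (Fin 2) ℤ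

/-- The variable `q`. -/
noncomputable def q : Coeff := MvPowerSeries.X 0

/-- The variable `Z`. -/
noncomputable def Z : Coeff := MvPowerSeries.X 1

/-- `D_n^B(q, Z)` seen in `ℤ⟦q, Z⟧`. -/
noncomputable def D (n : ℕ) : Coeff := (derangementPoly n : MvPowerSeries (Fin 2) ℤ)

/-- The quotient `a / b` in a commutative ring, for an invertible `b`. -/
noncomputable def quo {R : Type*} [CommRing R] (a b : R) : R := a * Ring.inverse b

/-- The `q`-ascending factorial `(a; p)_n`. -/
def qFactorial {R : Type*} [CommRing R] (a p : R) (n : ℕ) : R :=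
  ∏ k ∈ Finset.range n, (1 - a * p ^ k)

/-- The infinite `q`-ascending factorial `(a; p)_∞`. -/
noncomputable def qFactorialInf {R : Type*} [CommRing R] [TopologicalSpace R] (a p : R) : R :=
  ∏' k : ℕ, (1 - a * p ^ k)

/-- The Gaussian binomial coefficient `[n choose k]_p = (p; p)_n / ((p; p)_k (p; p)_{n-k})`,
for `k ≤ n` and `(p; p)_n` invertible. -/
noncomputable def qBinom {R : Type*} [CommRing R] (p : R) (n k : ℕ) : R :=
  quo (qFactorial p p n) (qFactorial p p k * qFactorial p p (n - k))

/-- The variable `u` of `ℤ⟦q, Z⟧⟦u⟧`. -/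
noncomputable def u : PowerSeries Coeff := PowerSeries.X

/-- The embedding of the coefficients in `ℤ⟦q, Z⟧⟦u⟧`. -/
noncomputable def const (a : Coeff) : PowerSeries Coeff := PowerSeries.C a

/-! All denominators that occur below are invertible. -/

theorem isUnit_one_sub_q_sq : IsUnit (1 - q ^ 2) := by
  rw [MvPowerSeries.isUnit_iff_constantCoeff]
  simp [q]

theorem isUnit_qFactorial (n : ℕ) : IsUnit (qFactorial (q ^ 2) (q ^ 2) n) := by
  rw [MvPowerSeries.isUnit_iff_constantCoeff]
  simp [q, qFactorial]

theorem isUnit_one_sub_u_mul (a : Coeff) : IsUnit (1 - u * const a) := by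
  rw [PowerSeries.isUnit_iff_constantCoeff]
  simp [u, const]

/-! ### The five forms, for a sequence `a` in place of `D_n^B(q, Z)` -/

/-- `∑ uⁿ a_n / (q²; q²)_n = (1 - u (1 + q Z) / (1 - q²))⁻¹ (u; q²)_∞`. -/
def FactorialGenFun (a : ℕ → Coeff) : Prop :=
  PowerSeries.mk (fun n => quo (a n) (qFactorial (q ^ 2) (q ^ 2) n)) =
    Ring.inverse (1 - u * const (quo (1 + q * Z) (1 - q ^ 2))) *
      qFactorialInf u (const (q ^ 2))

/-- `(q²; q²)_n / (1 - q²)ⁿ (1 + q Z)ⁿ = ∑_{k ≤ n} [n choose k]_{q²} a_k`. -/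
def BinomialSum (a : ℕ → Coeff) : Prop :=
  ∀ n : ℕ, quo (qFactorial (q ^ 2) (q ^ 2) n) ((1 - q ^ 2) ^ n) * (1 + q * Z) ^ n =
    ∑ k ∈ Finset.range (n + 1), qBinom (q ^ 2) n k * a k

/-- `a_n = ∑_{k ≤ n} [n choose k]_{q²} (-1)^k q^{k(k-1)} (q²; q²)_{n-k} / (1 - q²)^{n-k}
(1 + q Z)^{n-k}`. -/
def AlternatingSum (a : ℕ → Coeff) : Prop :=
  ∀ n : ℕ, a n = ∑ k ∈ Finset.range (n + 1),
    qBinom (q ^ 2) n k * (-1) ^ k * q ^ (k * (k - 1)) *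
      quo (qFactorial (q ^ 2) (q ^ 2) (n - k)) ((1 - q ^ 2) ^ (n - k)) * (1 + q * Z) ^ (n - k)

/-- The recurrence of order one. -/
def FirstRecurrence (a : ℕ → Coeff) : Prop :=
  a 0 = 1 ∧ ∀ n : ℕ, a (n + 1) =
    (1 + q * Z) * quo (1 - q ^ (2 * n + 2)) (1 - q ^ 2) * a n + (-1) ^ (n + 1) * q ^ (n * (n + 1))

/-- The recurrence of order two. -/
def SecondRecurrence (a : ℕ → Coeff) : Prop :=
  a 0 = 1 ∧ a 1 = Z * q ∧ ∀ n : ℕ, 1 ≤ n → a (n + 1) =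
    (quo (1 - q ^ (2 * n)) (1 - q ^ 2) + q * Z * quo (1 - q ^ (2 * n + 2)) (1 - q ^ 2)) * a n +
      (1 + q * Z) * q ^ (2 * n) * quo (1 - q ^ (2 * n)) (1 - q ^ 2) * a (n - 1)

end SignedDerangement

namespace SignedDerangement

open PowerSeries (mk coeff C X rescale)

/-! ### Quotients and `q`-factorials -/

/-! Equivalence of the five forms is formal. Euler's expansions say that `(u; q²)_∞` is
`eulerSeries` and that its inverse is `eulerInvSeries`. Comparing coefficients in the generating
function then gives the alternating sum; multiplying by `eulerInvSeries` gives the binomial sum;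
multiplying by `1 - u * ratio` gives the first recurrence. The second recurrence is the sum of the
first at one index and a multiple of the first at the index before.

It remains to prove one form for `D`, and `binomialSum_D` proves the binomial sum by computing `∑ p
^ maj w * t ^ neg w` over all signed permutations in two ways, with `p = q²` and `t = qZ`. If signs
are attached to values, MacMahon's formula (`sum_wordMaj_perm`) gives the product side. On the other
hand, deleting the positive fixed points leaves a signed derangement `v` of some order `k`, and `v`
with the positions of the deleted points determines `w` (`inflate`).

The key is `sum_shuffleMaj`: inserting zeros into a word of nonzero letters in all possible ways
multiplies `p ^ maj` by a Gaussian binomial. It needs only a descent predicate and a sign predicate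
that are compatible at sign changes. Inserted fixed points behave like zeros, excedances like
positive letters and the other letters like negative ones, so the lemma applies to derangements.
With a single zero it also gives the induction step of MacMahon's formula. -/

theorem quo_eq_iff {R : Type*} [CommRing R] {a b x : R} (hb : IsUnit b) :
    quo a b = x ↔ a = x * b := by
  obtain ⟨b, rfl⟩ := hb
  rw [quo, Ring.inverse_unit, Units.mul_inv_eq_iff_eq_mul]

theorem quo_mul_cancel {R : Type*} [CommRing R] (a : R) {b : R} (hb : IsUnit b) :
    quo a b * b = a :=
  ((quo_eq_iff hb).1 rfl).symm

theorem quo_pow {R : Type*} [CommRing R] (a b : R) (n : ℕ) :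
    quo a b ^ n = quo (a ^ n) (b ^ n) := by
  rw [quo, quo, mul_pow, Ring.inverse_pow]

theorem qFactorial_succ {R : Type*} [CommRing R] (p : R) (n : ℕ) :
    qFactorial p p (n + 1) = qFactorial p p n * (1 - p ^ (n + 1)) := by
  rw [qFactorial, Finset.prod_range_succ, ← pow_succ']; rfl

/-- The `q`-factorial `(q²; q²)_n`. -/
noncomputable abbrev qsqFactorial (n : ℕ) : Coeff := qFactorial (q ^ 2) (q ^ 2) n

/-- The inverse of `(q²; q²)_n`. -/
noncomputable def invFactorial (n : ℕ) : Coeff := Ring.inverse (qsqFactorial n)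

theorem qsqFactorial_mul_invFactorial (n : ℕ) : qsqFactorial n * invFactorial n = 1 :=
  Ring.mul_inverse_cancel _ (isUnit_qFactorial n)

theorem invFactorial_zero : invFactorial 0 = 1 := by
  simp [invFactorial, qsqFactorial, qFactorial]

theorem invFactorial_succ_mul (n : ℕ) :
    invFactorial (n + 1) * (1 - (q ^ 2) ^ (n + 1)) = invFactorial n := by
  have h0 := qsqFactorial_mul_invFactorial n
  have h1 := qsqFactorial_mul_invFactorial (n + 1)
  rw [qsqFactorial, qFactorial_succ] at h1
  linear_combination invFactorial n * h1 -
    invFactorial (n + 1) * (1 - (q ^ 2) ^ (n + 1)) * h0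

theorem isUnit_one_sub_pow (n : ℕ) : IsUnit (1 - (q ^ 2) ^ (n + 1) : Coeff) := by
  rw [MvPowerSeries.isUnit_iff_constantCoeff]
  simp [q]

/-! ### Euler's two series -/

/-- The series `∑ (-1)^n q^{n(n-1)} uⁿ / (q²; q²)_n`, which is the expansion of `(u; q²)_∞`. -/
noncomputable def eulerSeries : PowerSeries Coeff :=
  mk fun n => (-1) ^ n * q ^ (n * (n - 1)) * invFactorial n

/-- The series `∑ uⁿ / (q²; q²)_n`. -/
noncomputable def eulerInvSeries : PowerSeries Coeff := mk invFactorial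

theorem pow_sq_mul_pow (n : ℕ) :
    (q ^ 2) ^ n * q ^ (n * (n - 1)) = q ^ ((n + 1) * (n + 1 - 1)) := by
  rw [← pow_mul, ← pow_add]
  congr 1
  cases n with
  | zero => rfl
  | succ n => simp only [Nat.add_sub_cancel]; ring

theorem rescale_eulerSeries_mul : rescale (q ^ 2) eulerSeries * (1 - X) = eulerSeries := by
  ext1 n
  rw [mul_sub, mul_one, map_sub]
  cases n with
  | zero => simp [eulerSeries]
  | succ n =>
    rw [PowerSeries.coeff_succ_mul_X, PowerSeries.coeff_rescale, PowerSeries.coeff_rescale,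
      eulerSeries, PowerSeries.coeff_mk, PowerSeries.coeff_mk, ← pow_sq_mul_pow,
      ← invFactorial_succ_mul n]
    ring

theorem rescale_eulerInvSeries :
    rescale (q ^ 2) eulerInvSeries = (1 - X) * eulerInvSeries := by
  ext1 n
  rw [sub_mul, one_mul, map_sub]
  cases n with
  | zero => simp [eulerInvSeries]
  | succ n =>
    rw [PowerSeries.coeff_succ_X_mul, PowerSeries.coeff_rescale,
      eulerInvSeries, PowerSeries.coeff_mk, PowerSeries.coeff_mk, ← invFactorial_succ_mul n]
    ring

/-- The two functional equations make the product invariant under `u ↦ q² u`. Its coefficient of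
degree `n + 1` is therefore killed by the unit `1 - (q²)^(n + 1)`, and only the constant term
survives. -/
theorem eulerInvSeries_mul_eulerSeries : eulerInvSeries * eulerSeries = 1 := by
  have h : rescale (q ^ 2) (eulerInvSeries * eulerSeries) = eulerInvSeries * eulerSeries := by
    rw [map_mul, rescale_eulerInvSeries]
    conv_rhs => rw [← rescale_eulerSeries_mul]
    ring
  ext1 n
  cases n with
  | zero => simp [PowerSeries.coeff_mul, eulerInvSeries, eulerSeries, invFactorial_zero]
  | succ n =>
    have h' := congrArg (coeff (n + 1)) h
    rw [PowerSeries.coeff_rescale] at h'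
    have h2 : (1 - (q ^ 2) ^ (n + 1)) * coeff (n + 1) (eulerInvSeries * eulerSeries) = 0 := by
      linear_combination -h'
    rw [(isUnit_one_sub_pow n).mul_right_eq_zero.1 h2, PowerSeries.coeff_one, if_neg n.succ_ne_zero]

theorem prod_range_mul_rescale (N : ℕ) :
    (∏ k ∈ Finset.range N, (1 - X * C (q ^ 2) ^ k)) * rescale ((q ^ 2) ^ N) eulerSeries =
      eulerSeries := by
  induction N with
  | zero => simp
  | succ N ih =>
    have h := congrArg (rescale ((q ^ 2) ^ N)) rescale_eulerSeries_mul
    rw [map_mul, PowerSeries.rescale_rescale, map_sub, map_one, PowerSeries.rescale_X,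
      ← pow_succ'] at h
    rw [Finset.prod_range_succ]
    nth_rewrite 2 [← ih]
    rw [← h, map_pow C (q ^ 2) N]
    ring

theorem C_dvd_of_forall_dvd_coeff {R : Type*} [CommRing R] {a : R} {f : PowerSeries R}
    (h : ∀ n, a ∣ coeff n f) : C a ∣ f := by
  choose g hg using h
  refine ⟨mk g, ?_⟩
  ext1 n
  rw [PowerSeries.coeff_C_mul, PowerSeries.coeff_mk, hg]

theorem C_dvd_rescale_sub_one (N : ℕ) :
    C ((q ^ 2) ^ N) ∣ rescale ((q ^ 2) ^ N) eulerSeries - 1 := by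
  refine C_dvd_of_forall_dvd_coeff fun n => ?_
  rw [map_sub, PowerSeries.coeff_rescale, PowerSeries.coeff_one]
  cases n with
  | zero => simp [eulerSeries, invFactorial_zero]
  | succ n =>
    rw [if_neg n.succ_ne_zero, sub_zero, pow_succ' _ n, mul_assoc]
    exact dvd_mul_right _ _

theorem C_dvd_prod_sub_one (N : ℕ) (s : Finset ℕ) (hs : ∀ k ∈ s, N ≤ k) :
    C ((q ^ 2) ^ N) ∣ (∏ k ∈ s, (1 - X * C (q ^ 2) ^ k)) - 1 := by
  refine Finset.prod_induction (fun k => (1 - X * C (q ^ 2) ^ k : PowerSeries Coeff))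
    (fun f => C ((q ^ 2) ^ N) ∣ f - 1) (fun a b ha hb => ?_) (by simp) fun k hk => ?_
  · have : a * b - 1 = (a - 1) * b + (b - 1) := by ring
    rw [this]
    exact dvd_add (ha.mul_right b) hb
  · obtain ⟨j, rfl⟩ := Nat.exists_eq_add_of_le (hs k hk)
    exact ⟨-(X * C (q ^ 2) ^ j), by rw [map_pow C (q ^ 2) N]; ring⟩

/-- The product over `range N` is a common factor of both terms. The cofactors, the remaining
product and the rescaled Euler series, are both congruent to `1` modulo `q^(2N)`. -/
theorem C_dvd_prod_sub_eulerSeries (N : ℕ) (s : Finset ℕ) (hs : Finset.range N ⊆ s) :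
    C ((q ^ 2) ^ N) ∣ (∏ k ∈ s, (1 - X * C (q ^ 2) ^ k)) - eulerSeries := by
  rw [← Finset.prod_sdiff hs, mul_comm, ← prod_range_mul_rescale N, ← mul_sub]
  have h := dvd_sub (C_dvd_prod_sub_one N (s \ Finset.range N) (by simp))
    (C_dvd_rescale_sub_one N)
  rw [sub_sub_sub_cancel_right] at h
  exact h.mul_left _

theorem hasProd_eulerSeries : HasProd (fun k : ℕ => 1 - u * const (q ^ 2) ^ k) eulerSeries := by
  simp only [u, const]
  rw [HasProd, PowerSeries.WithPiTopology.tendsto_iff_coeff_tendsto]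
  intro n
  rw [MvPowerSeries.WithPiTopology.tendsto_iff_coeff_tendsto]
  intro m
  refine tendsto_const_nhds.congr' ?_
  rw [Filter.EventuallyEq]
  refine Filter.eventually_atTop.2 ⟨Finset.range (m 0 + 1), fun s hs => ?_⟩
  obtain ⟨g, hg⟩ := C_dvd_prod_sub_eulerSeries (m 0 + 1) s hs
  have h := congrArg (coeff n) hg
  rw [PowerSeries.coeff_C_mul, map_sub, ← pow_mul] at h
  have h0 : MvPowerSeries.coeff m (q ^ (2 * (m 0 + 1)) * coeff n g) = 0 :=
    MvPowerSeries.X_pow_dvd_iff.1 (dvd_mul_right _ _) m (by omega)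
  rw [← h, map_sub] at h0
  exact (sub_eq_zero.1 h0).symm

theorem qFactorialInf_eq : qFactorialInf u (const (q ^ 2)) = eulerSeries :=
  hasProd_eulerSeries.tprod_eq

/-! ### Equivalence of the five forms -/

/-- The ratio `(1 + q Z) / (1 - q²)`. -/
noncomputable abbrev ratio : Coeff := quo (1 + q * Z) (1 - q ^ 2)

theorem ratio_mul : ratio * (1 - q ^ 2) = 1 + q * Z := quo_mul_cancel _ isUnit_one_sub_q_sq

theorem quo_factorial_mul_pow (n : ℕ) :
    quo (qsqFactorial n) ((1 - q ^ 2) ^ n) * (1 + q * Z) ^ n = qsqFactorial n * ratio ^ n := by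
  rw [ratio, quo_pow, quo, quo]; ring

theorem qBinom_eq (n k : ℕ) :
    qBinom (q ^ 2) n k = qsqFactorial n * (invFactorial k * invFactorial (n - k)) := by
  rw [qBinom, quo, Ring.mul_inverse_rev, mul_comm (Ring.inverse _)]; rfl

theorem inverse_one_sub_mul (c : Coeff) :
    Ring.inverse (1 - u * const c) = mk fun n => c ^ n := by
  rw [← mul_one (Ring.inverse _), Ring.inverse_mul_eq_iff_eq_mul _ _ _ (isUnit_one_sub_u_mul c),
    u, const, sub_mul, one_mul]
  ext1 n
  cases n with
  | zero => simp
  | succ n =>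
    rw [map_sub, mul_assoc, PowerSeries.coeff_succ_X_mul, PowerSeries.coeff_C_mul,
      PowerSeries.coeff_mk, PowerSeries.coeff_mk, PowerSeries.coeff_one,
      if_neg n.succ_ne_zero]
    ring

theorem factorialGenFun_iff (a : ℕ → Coeff) :
    FactorialGenFun a ↔
      mk (fun n => a n * invFactorial n) = (mk fun n => ratio ^ n) * eulerSeries := by
  rw [FactorialGenFun, qFactorialInf_eq, inverse_one_sub_mul]; rfl

/-- After multiplication by `1 - u * ratio`, the constant coefficient is the initial value, and the
coefficient of degree `n + 1`, multiplied by `(q²; q²)_{n+1}`, is the recurrence. -/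
theorem factorialGenFun_iff_firstRecurrence (a : ℕ → Coeff) :
    FactorialGenFun a ↔ FirstRecurrence a := by
  rw [factorialGenFun_iff, ← inverse_one_sub_mul, eq_comm,
    Ring.inverse_mul_eq_iff_eq_mul _ _ _ (isUnit_one_sub_u_mul _), eq_comm, PowerSeries.ext_iff,
    u, const, sub_mul, one_mul, FirstRecurrence, ← Nat.and_forall_add_one]
  refine and_congr (by simp [invFactorial_zero, eulerSeries]) (forall_congr' fun n => ?_)
  rw [map_sub, mul_assoc, PowerSeries.coeff_succ_X_mul, PowerSeries.coeff_C_mul,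
    PowerSeries.coeff_mk, PowerSeries.coeff_mk, eulerSeries, PowerSeries.coeff_mk,
    ← invFactorial_succ_mul n, Nat.add_sub_cancel, mul_comm (n + 1) n]
  have hq : (q ^ 2) ^ (n + 1) = (q ^ (2 * n + 2) : Coeff) := by rw [← pow_mul]; congr 1
  have hr : (1 + q * Z) * quo (1 - q ^ (2 * n + 2)) (1 - q ^ 2) =
      ratio * (1 - (q ^ 2) ^ (n + 1)) := by
    rw [hq, ratio, quo, quo]; ring
  rw [hr]
  have h1 := qsqFactorial_mul_invFactorial (n + 1)
  constructor
  · intro h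
    linear_combination qsqFactorial (n + 1) * h - (a (n + 1) - ratio * (1 - (q ^ 2) ^ (n + 1)) * a n
      - (-1) ^ (n + 1) * q ^ (n * (n + 1))) * h1
  · intro h
    linear_combination invFactorial (n + 1) * h

theorem factorialGenFun_iff_alternatingSum (a : ℕ → Coeff) :
    FactorialGenFun a ↔ AlternatingSum a := by
  rw [factorialGenFun_iff, PowerSeries.ext_iff, AlternatingSum]
  refine forall_congr' fun n => ?_
  rw [mul_comm (mk _), PowerSeries.coeff_mul, PowerSeries.coeff_mk,
    Finset.Nat.sum_antidiagonal_eq_sum_range_succ_mk]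
  have hs : ∑ k ∈ Finset.range (n + 1),
      qBinom (q ^ 2) n k * (-1) ^ k * q ^ (k * (k - 1)) *
        quo (qFactorial (q ^ 2) (q ^ 2) (n - k)) ((1 - q ^ 2) ^ (n - k)) *
          (1 + q * Z) ^ (n - k) =
      qsqFactorial n * ∑ k ∈ Finset.range (n + 1),
        coeff k eulerSeries * coeff (n - k) (mk fun n => ratio ^ n) := by
    rw [Finset.mul_sum]
    refine Finset.sum_congr rfl fun k _ => ?_
    rw [mul_assoc, quo_factorial_mul_pow, qBinom_eq, eulerSeries, PowerSeries.coeff_mk,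
      PowerSeries.coeff_mk]
    linear_combination qsqFactorial n * invFactorial k * (-1) ^ k * q ^ (k * (k - 1)) *
      ratio ^ (n - k) * qsqFactorial_mul_invFactorial (n - k)
  rw [hs]
  have h1 := qsqFactorial_mul_invFactorial n
  constructor
  · intro h
    rw [← h]
    linear_combination -a n * h1
  · intro h
    rw [h]
    linear_combination (∑ k ∈ Finset.range (n + 1),
        coeff k eulerSeries * coeff (n - k) (mk fun n => ratio ^ n)) * h1

theorem factorialGenFun_iff_binomialSum (a : ℕ → Coeff) :
    FactorialGenFun a ↔ BinomialSum a := by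
  have h0 := eulerInvSeries_mul_eulerSeries
  have h1 : FactorialGenFun a ↔
      (mk fun n => ratio ^ n) = mk (fun n => a n * invFactorial n) * eulerInvSeries := by
    rw [factorialGenFun_iff]
    constructor
    · intro h
      rw [h]
      linear_combination -(mk fun n => ratio ^ n) * h0
    · intro h
      rw [h]
      linear_combination -(mk fun n => a n * invFactorial n) * h0
  rw [h1, PowerSeries.ext_iff, BinomialSum]
  refine forall_congr' fun n => ?_
  rw [PowerSeries.coeff_mul, PowerSeries.coeff_mk, quo_factorial_mul_pow,
    Finset.Nat.sum_antidiagonal_eq_sum_range_succ_mk]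
  have hs : ∑ k ∈ Finset.range (n + 1), qBinom (q ^ 2) n k * a k =
      qsqFactorial n * ∑ k ∈ Finset.range (n + 1),
        coeff k (mk fun n => a n * invFactorial n) * coeff (n - k) eulerInvSeries := by
    rw [Finset.mul_sum]
    refine Finset.sum_congr rfl fun k _ => ?_
    rw [qBinom_eq, eulerInvSeries, PowerSeries.coeff_mk, PowerSeries.coeff_mk]
    ring
  rw [hs, (isUnit_qFactorial n).mul_right_inj]

/-- Adding `q^(2(n+1))` times the first recurrence at `n` to the one at `n + 1` cancels the
alternating terms, because `(n+1)(n+2) = 2(n+1) + n(n+1)`. The converse removes this multiple again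
by induction. -/
theorem firstRecurrence_iff_secondRecurrence (a : ℕ → Coeff) :
    FirstRecurrence a ↔ SecondRecurrence a := by
  have hQ : ∀ n, quo (1 - q ^ n) (1 - q ^ 2) * (1 - q ^ 2) = 1 - q ^ n := fun n =>
    quo_mul_cancel _ isUnit_one_sub_q_sq
  have hQ2 : quo (1 - q ^ 2) (1 - q ^ 2) = (1 : Coeff) :=
    (quo_eq_iff isUnit_one_sub_q_sq).2 (one_mul _).symm
  have hQs : ∀ n : ℕ, quo (1 - q ^ (2 * n + 2)) (1 - q ^ 2) =
      quo (1 - q ^ (2 * n)) (1 - q ^ 2) + q ^ (2 * n) := fun n => by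
    rw [quo_eq_iff isUnit_one_sub_q_sq, add_mul, hQ]; ring
  constructor
  · rintro ⟨h0, h⟩
    refine ⟨h0, ?_, fun n hn => ?_⟩
    · rw [h 0, h0]
      simp only [mul_zero, zero_add, hQ2]
      ring
    · obtain ⟨n, rfl⟩ := Nat.exists_eq_add_of_le' hn
      have e1 := h n
      have e2 := h (n + 1)
      rw [← mul_add_one 2 n] at e1
      rw [hQs] at e2 ⊢
      rw [Nat.add_sub_cancel, e2]
      have e3 : (q : Coeff) ^ ((n + 1) * (n + 1 + 1)) = q ^ (2 * (n + 1)) * q ^ (n * (n + 1)) := by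
        rw [← pow_add]; congr 1; ring
      rw [e3]
      linear_combination q ^ (2 * (n + 1)) * e1
  · rintro ⟨h0, h1, h⟩
    refine ⟨h0, fun n => ?_⟩
    induction n with
    | zero =>
      rw [h1, h0]
      simp only [mul_zero, zero_add, hQ2]
      ring
    | succ n e1 =>
      have e2 := h (n + 1) (by omega)
      rw [← mul_add_one 2 n] at e1
      rw [hQs] at e2 ⊢
      rw [Nat.add_sub_cancel] at e2
      rw [e2]
      have e3 : (q : Coeff) ^ ((n + 1) * (n + 1 + 1)) = q ^ (2 * (n + 1)) * q ^ (n * (n + 1)) := by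
        rw [← pow_add]; congr 1; ring
      rw [e3]
      linear_combination -q ^ (2 * (n + 1)) * e1

theorem tfae_forms (a : ℕ → Coeff) : List.TFAE
    [FactorialGenFun a, BinomialSum a, AlternatingSum a, FirstRecurrence a,
      SecondRecurrence a] := by
  tfae_have 1 ↔ 2 := factorialGenFun_iff_binomialSum a
  tfae_have 1 ↔ 3 := factorialGenFun_iff_alternatingSum a
  tfae_have 1 ↔ 4 := factorialGenFun_iff_firstRecurrence a
  tfae_have 4 ↔ 5 := firstRecurrence_iff_secondRecurrence a
  tfae_finish

/-! ### Gaussian binomial coefficients by Pascal's rule -/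

/-- The Gaussian binomial coefficient, as a polynomial in `p`. -/
def gaussian {R : Type*} [CommRing R] (p : R) : ℕ → ℕ → R
  | _, 0 => 1
  | 0, _ + 1 => 0
  | n + 1, k + 1 => gaussian p n k + p ^ (k + 1) * gaussian p n (k + 1)

section Gaussian

variable {R : Type*} [CommRing R] (p : R)

@[simp] theorem gaussian_zero_right (n : ℕ) : gaussian p n 0 = 1 := by cases n <;> rfl

@[simp] theorem gaussian_zero_succ (k : ℕ) : gaussian p 0 (k + 1) = 0 := rfl

theorem gaussian_succ_succ (n k : ℕ) :
    gaussian p (n + 1) (k + 1) = gaussian p n k + p ^ (k + 1) * gaussian p n (k + 1) := rfl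

theorem gaussian_eq_zero_of_lt {n k : ℕ} (h : n < k) : gaussian p n k = 0 := by
  induction n generalizing k with
  | zero => cases k with
    | zero => omega
    | succ k => rfl
  | succ n ih => cases k with
    | zero => omega
    | succ k => rw [gaussian_succ_succ, ih (by omega), ih (by omega)]; ring

/-- This is exactly the difference between the two forms of Pascal's rule, stated without division
so that it holds in every commutative ring. -/
theorem one_sub_pow_mul_gaussian {n k : ℕ} (h : k ≤ n) :
    (1 - p ^ (k + 1)) * gaussian p n (k + 1) = (1 - p ^ (n - k)) * gaussian p n k := by
  induction n generalizing k with
  | zero => obtain rfl : k = 0 := by omega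
            simp
  | succ n ih => cases k with
    | zero =>
      have := ih (Nat.zero_le n)
      simp only [gaussian_succ_succ, gaussian_zero_right, Nat.sub_zero, zero_add, pow_one,
        mul_one] at this ⊢
      linear_combination p * this
    | succ k =>
      have h1 := ih (k := k) (by omega)
      rw [gaussian_succ_succ, gaussian_succ_succ, Nat.add_sub_add_right]
      have e1 : p ^ (n - k) * p ^ (k + 1) = p ^ (n + 1) := by
        rw [← pow_add]; congr 1; omega
      rcases Nat.lt_or_ge k n with hk | hk
      · have h2 := ih (k := k + 1) hk
        have e2 : p ^ (n - (k + 1)) * p ^ (k + 2) = p ^ (n + 1) := by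
          rw [← pow_add]; congr 1; omega
        linear_combination p ^ (k + 2) * h2 + h1 -
          gaussian p n (k + 1) * e2 + gaussian p n (k + 1) * e1
      · obtain rfl : k = n := by omega
        rw [gaussian_eq_zero_of_lt p (show k < k + 1 by omega),
          gaussian_eq_zero_of_lt p (show k < k + 1 + 1 by omega)]
        simp

theorem gaussian_succ_succ' (n k : ℕ) :
    gaussian p (n + 1) (k + 1) = p ^ (n - k) * gaussian p n k + gaussian p n (k + 1) := by
  rcases Nat.lt_or_ge n k with h | h
  · simp [gaussian_eq_zero_of_lt p h, gaussian_eq_zero_of_lt p (show n < k + 1 by omega),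
      gaussian_eq_zero_of_lt p (show n + 1 < k + 1 by omega)]
  · rw [gaussian_succ_succ]
    linear_combination -one_sub_pow_mul_gaussian p h

theorem gaussian_self (n : ℕ) : gaussian p n n = 1 := by
  induction n with
  | zero => rfl
  | succ n ih => rw [gaussian_succ_succ, ih, gaussian_eq_zero_of_lt p n.lt_succ_self]; ring

theorem gaussian_succ_self (n : ℕ) :
    gaussian p (n + 1) n = ∑ i ∈ Finset.range (n + 1), p ^ i := by
  induction n with
  | zero => simp
  | succ n ih =>
    rw [gaussian_succ_succ, ih, gaussian_self, Finset.sum_range_succ _ (n + 1), mul_one]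

theorem gaussian_mul_qFactorial {n k : ℕ} (h : k ≤ n) :
    gaussian p n k * (qFactorial p p k * qFactorial p p (n - k)) = qFactorial p p n := by
  induction n generalizing k with
  | zero => obtain rfl : k = 0 := by omega
            simp [qFactorial]
  | succ n ih => cases k with
    | zero => simp [qFactorial]
    | succ k =>
      have h1 := ih (k := k) (by omega)
      rw [gaussian_succ_succ, Nat.add_sub_add_right, qFactorial_succ p n]
      rcases Nat.lt_or_ge k n with hk | hk
      · have h2 := ih (k := k + 1) hk
        obtain ⟨j, rfl⟩ := Nat.exists_eq_add_of_lt hk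
        rw [show k + j + 1 - (k + 1) = j by omega] at h2
        rw [show k + j + 1 - k = j + 1 by omega] at h1 ⊢
        rw [qFactorial_succ p j] at h1
        rw [qFactorial_succ p k] at h2 ⊢
        rw [qFactorial_succ p j]
        have e : p ^ (k + j + 1 + 1) = p ^ (k + 1) * p ^ (j + 1) := by
          rw [← pow_add]; congr 1; omega
        rw [e]
        linear_combination (1 - p ^ (k + 1)) * h1 + p ^ (k + 1) * (1 - p ^ (j + 1)) * h2
      · obtain rfl : k = n := by omega
        rw [gaussian_eq_zero_of_lt p k.lt_succ_self, gaussian_self, Nat.sub_self,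
          qFactorial_succ]
        simp [qFactorial]

end Gaussian

/-! ### The major index of a shuffle with a constant word -/

open Classical in
/-- The major index of a word of length `n + 1` with descent predicate `d`
(positions counted from `0`). -/
noncomputable def descentSum (d : ℕ → Prop) (n : ℕ) : ℕ :=
  ∑ i ∈ Finset.range n, if d i then i + 1 else 0

/-- The number of elements of `T` below `i`. -/
def rankIn (T : Finset ℕ) (i : ℕ) : ℕ := (T.filter (· < i)).card

/-- The descents of the word that has zeros at the positions outside `T` and, at the positions in
`T`, the successive letters of a word `v` of nonzero numbers, where `d` is the descent predicate
of `v` and `s a` says that the letter at position `a` of `v` is positive. -/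
def ShuffleDescent (d s : ℕ → Prop) (T : Finset ℕ) (i : ℕ) : Prop :=
  (i ∈ T ∧ i + 1 ∈ T ∧ d (rankIn T i)) ∨ (i ∈ T ∧ i + 1 ∉ T ∧ s (rankIn T i)) ∨
    (i ∉ T ∧ i + 1 ∈ T ∧ ¬ s (rankIn T (i + 1)))

/-- The major index of the shuffle of length `n + 1` described at `ShuffleDescent`. -/
noncomputable def shuffleMaj (d s : ℕ → Prop) (n : ℕ) (T : Finset ℕ) : ℕ :=
  descentSum (ShuffleDescent d s T) n

theorem descentSum_congr {d d' : ℕ → Prop} {n : ℕ} (h : ∀ i < n, (d i ↔ d' i)) :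
    descentSum d n = descentSum d' n := by
  classical
  exact Finset.sum_congr rfl fun i hi => if_congr (h i (Finset.mem_range.1 hi)) rfl rfl

open Classical in
theorem descentSum_succ (d : ℕ → Prop) (n : ℕ) :
    descentSum d (n + 1) = descentSum d n + if d n then n + 1 else 0 :=
  Finset.sum_range_succ _ _

theorem rankIn_insert_of_le {T : Finset ℕ} {i j : ℕ} (h : i ≤ j) :
    rankIn (insert j T) i = rankIn T i := by
  rw [rankIn, Finset.filter_insert, if_neg (by omega), rankIn]

theorem rankIn_eq_card {T : Finset ℕ} {n i : ℕ} (hT : T ⊆ Finset.range n) (h : n ≤ i) :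
    rankIn T i = T.card := by
  rw [rankIn, Finset.filter_true_of_mem fun x hx => ?_]
  have := Finset.mem_range.1 (hT hx)
  omega

/-- A shuffle of length `n + 1` occupies the positions `0, …, n`, so membership of `n + 1` in `T` is
invisible to it. -/
theorem shuffleMaj_insert (d s : ℕ → Prop) (n : ℕ) (T : Finset ℕ) :
    shuffleMaj d s n (insert (n + 1) T) = shuffleMaj d s n T := by
  refine descentSum_congr fun i hi => ?_
  have h1 : i ≠ n + 1 := by omega
  have h2 : i ≠ n := by omega
  simp only [ShuffleDescent, Finset.mem_insert, h1, Nat.add_right_cancel_iff, h2, false_or,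
    rankIn_insert_of_le (show i ≤ n + 1 by omega),
    rankIn_insert_of_le (show i + 1 ≤ n + 1 by omega)]

section Step

variable (d s : ℕ → Prop) {n k : ℕ} {T : Finset ℕ} (hT : T ∈ Finset.powersetCard k (Finset.range n))
include hT

theorem notMem_of_le {i : ℕ} (h : n ≤ i) : i ∉ T := fun hi => by
  have := Finset.mem_range.1 ((Finset.mem_powersetCard.1 hT).1 hi)
  omega

/-- Appending position `n + 1` adds `n + 1` to the major index exactly when there is a descent at
`n`. This lemma and the next three cover the four choices of zero or letter at the last two
positions; as `k` letters lie before position `n`, the first letter placed there has index `k`. -/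
theorem shuffleMaj_succ : shuffleMaj d s (n + 1) T = shuffleMaj d s n T := by
  rw [shuffleMaj, descentSum_succ, if_neg, add_zero, shuffleMaj]
  simp [ShuffleDescent, notMem_of_le hT (le_refl n), notMem_of_le hT (Nat.le_succ n)]

open Classical in
theorem shuffleMaj_succ_insert : shuffleMaj d s (n + 1) (insert n T) =
    shuffleMaj d s n (insert n T) + if s k then n + 1 else 0 := by
  rw [shuffleMaj, descentSum_succ, shuffleMaj]
  congr 1
  refine if_congr ?_ rfl rfl
  obtain ⟨h1, h2⟩ := Finset.mem_powersetCard.1 hT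
  simp [ShuffleDescent, notMem_of_le hT (Nat.le_succ n), rankIn_insert_of_le,
    rankIn_eq_card h1, h2]

open Classical in
theorem shuffleMaj_succ_insert_succ : shuffleMaj d s (n + 1) (insert (n + 1) T) =
    shuffleMaj d s n T + if s k then 0 else n + 1 := by
  rw [shuffleMaj, descentSum_succ, ← ite_not, ← shuffleMaj_insert d s n T, shuffleMaj]
  congr 1
  refine if_congr ?_ rfl rfl
  obtain ⟨h1, h2⟩ := Finset.mem_powersetCard.1 hT
  simp [ShuffleDescent, notMem_of_le hT (le_refl n), rankIn_insert_of_le,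
    rankIn_eq_card h1 (Nat.le_succ n), h2]

open Classical in
theorem shuffleMaj_succ_insert_insert :
    shuffleMaj d s (n + 1) (insert (n + 1) (insert n T)) =
      shuffleMaj d s n (insert n T) + if d k then n + 1 else 0 := by
  rw [shuffleMaj, descentSum_succ, ← shuffleMaj_insert d s n (insert n T), shuffleMaj]
  congr 1
  refine if_congr ?_ rfl rfl
  obtain ⟨h1, h2⟩ := Finset.mem_powersetCard.1 hT
  simp [ShuffleDescent, rankIn_insert_of_le, rankIn_eq_card h1, h2]

end Step

theorem sum_powersetCard_range_succ {M : Type*} [AddCommMonoid M] (f : Finset ℕ → M) (n k : ℕ) :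
    ∑ T ∈ Finset.powersetCard (k + 1) (Finset.range (n + 1)), f T =
      ∑ T ∈ Finset.powersetCard (k + 1) (Finset.range n), f T +
        ∑ T ∈ Finset.powersetCard k (Finset.range n), f (insert n T) := by
  rw [Finset.range_add_one, Finset.powersetCard_succ_insert (by simp), Finset.sum_union,
    Finset.sum_image]
  · intro T hT T' hT' h
    rw [← Finset.erase_insert (notMem_of_le hT (le_refl n)), h,
      Finset.erase_insert (notMem_of_le hT' (le_refl n))]
  · refine Finset.disjoint_left.2 fun T hT hT' => ?_
    obtain ⟨S, -, rfl⟩ := Finset.mem_image.1 hT'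
    exact notMem_of_le hT (le_refl n) (Finset.mem_insert_self n S)

section Shuffle

variable {R : Type*} [CommRing R] (p : R) {d s : ℕ → Prop} {K : ℕ}

open Classical in
/-- The distribution of the major index on the shuffles that end with a zero, and on those that
end with the last letter of the word. -/
theorem sum_shuffleMaj_last
    (h1 : ∀ a, a + 1 < K → s a → ¬ s (a + 1) → d a)
    (h2 : ∀ a, a + 1 < K → ¬ s a → s (a + 1) → ¬ d a) (n : ℕ) :
    ∀ k < K,
    (∑ T ∈ Finset.powersetCard (k + 1) (Finset.range n), p ^ shuffleMaj d s n T =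
      p ^ descentSum d k * gaussian p n (k + 1) * if s k then p ^ (k + 1) else 1) ∧
    (∑ T ∈ Finset.powersetCard k (Finset.range n), p ^ shuffleMaj d s n (insert n T) =
      p ^ descentSum d k * gaussian p n k * if s k then 1 else p ^ (n - k)) := by
  induction n with
  | zero =>
    intro k _
    have h0 : ∀ j, Finset.powersetCard (j + 1) (∅ : Finset ℕ) = ∅ := fun j =>
      Finset.powersetCard_eq_empty.2 (by simp)
    refine ⟨by simp [h0], ?_⟩
    cases k with
    | zero => simp [shuffleMaj, descentSum]
    | succ k => simp [h0]
  | succ n ih =>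
    have hA : ∀ T ∈ Finset.powersetCard 0 (Finset.range n), p ^ shuffleMaj d s n T = 1 := by
      intro T hT
      rw [Finset.powersetCard_zero, Finset.mem_singleton] at hT
      subst hT
      simp [shuffleMaj, descentSum, ShuffleDescent]
    have hp : ∀ k ≤ n, p ^ (n + 1) = p ^ (k + 1) * p ^ (n - k) := fun k hk => by
      rw [← pow_add]; congr 1; omega
    intro k hk
    constructor
    -- The last position `n + 1` holds a zero; the sum splits according to whether position `n`
    -- holds a zero or the letter `k`.
    · obtain ⟨ih1, ih2⟩ := ih k hk
      have e1 : ∑ T ∈ Finset.powersetCard (k + 1) (Finset.range n), p ^ shuffleMaj d s (n + 1) T =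
          ∑ T ∈ Finset.powersetCard (k + 1) (Finset.range n), p ^ shuffleMaj d s n T :=
        Finset.sum_congr rfl fun T hT => by rw [shuffleMaj_succ d s hT]
      have e2 : ∑ T ∈ Finset.powersetCard k (Finset.range n),
            p ^ shuffleMaj d s (n + 1) (insert n T) =
          (∑ T ∈ Finset.powersetCard k (Finset.range n), p ^ shuffleMaj d s n (insert n T)) *
            p ^ (if s k then n + 1 else 0) := by
        rw [Finset.sum_mul]
        exact Finset.sum_congr rfl fun T hT => by rw [shuffleMaj_succ_insert d s hT, pow_add]
      rw [sum_powersetCard_range_succ, e1, e2, ih1, ih2]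
      rcases Nat.lt_or_ge n k with hk' | hk'
      · rw [gaussian_eq_zero_of_lt p hk', gaussian_eq_zero_of_lt p (show n < k + 1 by omega),
          gaussian_eq_zero_of_lt p (show n + 1 < k + 1 by omega)]
        ring
      · split_ifs
        · rw [gaussian_succ_succ', hp k hk']; ring
        · rw [gaussian_succ_succ']; ring
    · cases k with
      | zero =>
        rw [Finset.sum_congr (g := fun _ => if s 0 then 1 else p ^ (n + 1)) rfl
          fun T hT => ?_]
        · simp [descentSum]
        · rw [Finset.powersetCard_zero] at hT
          rw [← Finset.powersetCard_zero (Finset.range n)] at hT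
          rw [shuffleMaj_succ_insert_succ d s hT, pow_add, hA T hT]
          split_ifs <;> simp
      | succ k =>
        obtain ⟨ih1, ih2⟩ := ih k (by omega)
        have hd1 := h1 k hk
        have hd2 := h2 k hk
        -- The last position `n + 1` holds the letter `k + 1`; position `n` holds a zero or the
        -- letter `k`.
        have e1 : ∑ T ∈ Finset.powersetCard (k + 1) (Finset.range n),
              p ^ shuffleMaj d s (n + 1) (insert (n + 1) T) =
            (∑ T ∈ Finset.powersetCard (k + 1) (Finset.range n), p ^ shuffleMaj d s n T) *
              p ^ (if s (k + 1) then 0 else n + 1) := by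
          rw [Finset.sum_mul]
          exact Finset.sum_congr rfl fun T hT => by
            rw [shuffleMaj_succ_insert_succ d s hT, pow_add]
        have e2 : ∑ T ∈ Finset.powersetCard k (Finset.range n),
              p ^ shuffleMaj d s (n + 1) (insert (n + 1) (insert n T)) =
            (∑ T ∈ Finset.powersetCard k (Finset.range n), p ^ shuffleMaj d s n (insert n T)) *
              p ^ (if d k then n + 1 else 0) := by
          rw [Finset.sum_mul]
          exact Finset.sum_congr rfl fun T hT => by
            rw [shuffleMaj_succ_insert_insert d s hT, pow_add]
        rw [sum_powersetCard_range_succ, e1, e2, ih1, ih2, descentSum_succ, pow_add,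
          Nat.add_sub_add_right]
        rcases Nat.lt_or_ge n k with hk' | hk'
        · rw [gaussian_eq_zero_of_lt p hk', gaussian_eq_zero_of_lt p (show n < k + 1 by omega),
            gaussian_eq_zero_of_lt p (show n + 1 < k + 1 by omega)]
          ring
        · have g1 := gaussian_succ_succ p n k
          have g2 := gaussian_succ_succ' p n k
          have hp' := hp k hk'
          -- Compatibility at sign changes excludes two of the eight cases; each of the others is
          -- one of the two Pascal rules.
          by_cases hs : s k <;> by_cases hs' : s (k + 1) <;> by_cases hd : d k <;>
            simp only [hs, hs', hd, if_true, if_false, pow_zero, mul_one, true_imp_iff,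
              not_true_eq_false, not_false_eq_true] at hd1 hd2 ⊢
          · rw [g2, hp']; ring
          · rw [g1]; ring
          · rw [g1, hp']; ring
          · rw [g2]; ring
          · rw [g2, hp']; ring
          · rw [g1, hp']; ring

/-- The distribution of the major index on the shuffles of a word of length `k` with `n - k`
zeros. -/
theorem sum_shuffleMaj
    (h1 : ∀ a, a + 1 < K → s a → ¬ s (a + 1) → d a)
    (h2 : ∀ a, a + 1 < K → ¬ s a → s (a + 1) → ¬ d a) (n : ℕ) :
    ∑ T ∈ Finset.powersetCard K (Finset.range n), p ^ shuffleMaj d s (n - 1) T =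
      p ^ descentSum d (K - 1) * gaussian p n K := by
  classical
  cases K with
  | zero => simp [shuffleMaj, descentSum, ShuffleDescent]
  | succ k => cases n with
    | zero =>
      rw [Finset.powersetCard_eq_empty.2 (by simp)]
      simp
    | succ n =>
      obtain ⟨e1, e2⟩ := sum_shuffleMaj_last p h1 h2 n k k.lt_succ_self
      rw [sum_powersetCard_range_succ, Nat.add_sub_cancel, Nat.add_sub_cancel, e1, e2]
      -- The sign of the last letter decides which form of Pascal's rule has the two totals as its
      -- terms.
      split_ifs
      · rw [gaussian_succ_succ]; ring
      · rw [gaussian_succ_succ']; ring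

end Shuffle

/-! ### Words and their major index -/

/-- The word `f` has a descent at position `i` (counted from `0`). -/
def WordDescent {n : ℕ} (f : Fin n → ℤ) (i : ℕ) : Prop :=
  ∃ h : i + 1 < n, f ⟨i + 1, h⟩ < f ⟨i, Nat.lt_of_succ_lt h⟩

/-- The major index of the word `f`. -/
noncomputable def wordMaj {n : ℕ} (f : Fin n → ℤ) : ℕ := descentSum (WordDescent f) (n - 1)

theorem maj_eq_wordMaj {n : ℕ} (w : SignedPerm n) : maj w = wordMaj (letter w) := by
  classical
  cases n with
  | zero => simp [maj, wordMaj, descentSum]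
  | succ n =>
    rw [maj, Fin.sum_univ_castSucc, wordMaj, descentSum, Nat.add_sub_cancel,
      ← Fin.sum_univ_eq_sum_range (fun i => if WordDescent (letter w) i then i + 1 else 0)]
    simp only [Fin.val_last, lt_irrefl, dite_false, add_zero]
    refine Finset.sum_congr rfl fun i _ => ?_
    have hi : (i.castSucc : ℕ) + 1 < n + 1 := by simp
    rw [dif_pos hi]
    refine if_congr ?_ rfl rfl
    exact ⟨fun h => ⟨hi, h⟩, fun ⟨_, h⟩ => h⟩

section Embedding

variable {k n : ℕ} (e : Fin k ↪o Fin n)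

/-- The set of values of an embedding `Fin k ↪o Fin n`, as natural numbers. -/
def valueSet : Finset ℕ := Finset.univ.map (e.toEmbedding.trans Fin.valEmbedding)

theorem mem_valueSet {i : Fin n} : (i : ℕ) ∈ valueSet e ↔ ∃ a, e a = i := by
  simp [valueSet, Fin.val_inj]

theorem rankIn_valueSet (a : Fin k) : rankIn (valueSet e) (e a) = a := by
  have h : (valueSet e).filter (· < (e a : ℕ)) =
      (Finset.Iio a).map (e.toEmbedding.trans Fin.valEmbedding) := by
    ext i
    simp only [valueSet, Finset.mem_filter, Finset.mem_map, Finset.mem_univ, true_and,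
      Finset.mem_Iio]
    constructor
    · rintro ⟨⟨b, rfl⟩, hb⟩
      exact ⟨b, e.lt_iff_lt.1 hb, rfl⟩
    · rintro ⟨b, hb, rfl⟩
      exact ⟨⟨b, rfl⟩, e.lt_iff_lt.2 hb⟩
  rw [rankIn, h, Finset.card_map, Fin.card_Iio]

/-- Otherwise the image of `a + 1` would lie strictly between two consecutive numbers. -/
theorem val_succ_of_apply_succ {a b : Fin k} (h : (e b : ℕ) = e a + 1) : (b : ℕ) = a + 1 := by
  have hab : a < b := e.lt_iff_lt.1 (Fin.lt_def.2 (by omega))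
  have hab' : (a : ℕ) < b := hab
  by_contra hne
  have hb := b.2
  let c : Fin k := ⟨a + 1, by omega⟩
  have h1 : e a < e c := e.lt_iff_lt.2 (Fin.lt_def.2 (Nat.lt_succ_self _))
  have h2 : e c < e b := e.lt_iff_lt.2 (Fin.lt_def.2 (show (a : ℕ) + 1 < b by omega))
  rw [Fin.lt_def] at h1 h2
  omega

/-- The major index sees only comparisons of neighbours, so letters off the range of `e` may be
replaced by zeros once they compare with their neighbours as zeros would. This serves both the
insertion of one letter and the insertion of fixed points. -/
theorem wordMaj_eq_shuffleMaj (g : Fin n → ℤ) (d s : ℕ → Prop)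
    (hd : ∀ a b : Fin k, (b : ℕ) = a + 1 → (g (e b) < g (e a) ↔ d a))
    (hs : ∀ (a : Fin k) (i : Fin n), (∀ b, e b ≠ i) → (i : ℕ) = e a + 1 → (g i < g (e a) ↔ s a))
    (hs' : ∀ (a : Fin k) (i : Fin n), (∀ b, e b ≠ i) → (e a : ℕ) = i + 1 →
      (g (e a) < g i ↔ ¬ s a))
    (h : ∀ i j : Fin n, (∀ b, e b ≠ i) → (∀ b, e b ≠ j) → (j : ℕ) = i + 1 → ¬ g j < g i) :
    wordMaj g = shuffleMaj d s (n - 1) (valueSet e) := by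
  refine descentSum_congr fun i hi => ?_
  obtain ⟨i, rfl⟩ : ∃ j : Fin n, (j : ℕ) = i := ⟨⟨i, by omega⟩, rfl⟩
  have hi' : (i : ℕ) + 1 < n := by omega
  obtain ⟨j, hj⟩ : ∃ j : Fin n, (j : ℕ) = i + 1 := ⟨⟨i + 1, hi'⟩, rfl⟩
  have hw : WordDescent g i ↔ g j < g i := by
    have : j = ⟨i + 1, hi'⟩ := Fin.ext hj
    subst this
    exact ⟨fun ⟨_, h⟩ => h, fun h => ⟨hi', h⟩⟩
  rw [hw, ShuffleDescent, ← hj, mem_valueSet, mem_valueSet]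
  by_cases h1 : ∃ a, e a = i
  · obtain ⟨a, rfl⟩ := h1
    rw [rankIn_valueSet]
    by_cases h2 : ∃ b, e b = j
    · obtain ⟨b, rfl⟩ := h2
      simp [hd a b (val_succ_of_apply_succ e hj)]
    · have := hs a j (not_exists.1 h2) hj
      simp [h2, this]
  · by_cases h2 : ∃ b, e b = j
    · obtain ⟨b, rfl⟩ := h2
      rw [rankIn_valueSet]
      have := hs' b i (not_exists.1 h1) hj
      simp [h1, this]
    · have := h i j (not_exists.1 h1) (not_exists.1 h2) hj
      simp [h1, h2, this]

end Embedding

theorem sum_powersetCard_univ {M : Type*} [AddCommMonoid M] (F : Finset ℕ → M) (n k : ℕ) :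
    ∑ T ∈ Finset.powersetCard k (Finset.univ : Finset (Fin n)), F (T.map Fin.valEmbedding) =
      ∑ T ∈ Finset.powersetCard k (Finset.range n), F T := by
  have h : Finset.range n = (Finset.univ : Finset (Fin n)).map Fin.valEmbedding := by
    ext i
    simp only [Finset.mem_range, Finset.mem_map, Finset.mem_univ, true_and]
    exact ⟨fun h => ⟨⟨i, h⟩, rfl⟩, fun ⟨j, hj⟩ => hj ▸ j.2⟩
  rw [h, Finset.powersetCard_map, Finset.sum_map]
  rfl

/-! ### Rearrangements of a word with distinct letters -/

/-- The permutation that takes the value `0` at `i`, and elsewhere the values of `τ` raised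
by one. -/
def insertZero {n : ℕ} (i : Fin (n + 1)) (τ : Equiv.Perm (Fin n)) : Equiv.Perm (Fin (n + 1)) :=
  (finSuccEquiv' i).trans ((Equiv.optionCongr τ).trans (finSuccEquiv' 0).symm)

theorem insertZero_self {n : ℕ} (i : Fin (n + 1)) (τ : Equiv.Perm (Fin n)) :
    insertZero i τ i = 0 := by
  simp [insertZero]

theorem insertZero_succAbove {n : ℕ} (i : Fin (n + 1)) (τ : Equiv.Perm (Fin n)) (j : Fin n) :
    insertZero i τ (i.succAbove j) = (τ j).succ := by
  simp [insertZero]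

theorem insertZero_bijective (n : ℕ) : Function.Bijective
    fun x : Fin (n + 1) × Equiv.Perm (Fin n) => insertZero x.1 x.2 := by
  rw [Fintype.bijective_iff_injective_and_card]
  constructor
  · rintro ⟨i, τ⟩ ⟨j, τ'⟩ h
    simp only at h
    have hij : i = j := by
      apply (insertZero i τ).injective
      rw [insertZero_self, h, insertZero_self]
    subst hij
    refine Prod.ext rfl (Equiv.ext fun a => Fin.succ_injective _ ?_)
    simp only
    rw [← insertZero_succAbove i, h, insertZero_succAbove]
  · simp [Fintype.card_perm, Nat.factorial_succ]

theorem sum_powersetCard_succAbove {M : Type*} [AddCommMonoid M] (F : Finset ℕ → M) (n : ℕ) :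
    ∑ i : Fin (n + 1), F (valueSet (Fin.succAboveOrderEmb i)) =
      ∑ T ∈ Finset.powersetCard n (Finset.range (n + 1)), F T := by
  rw [← sum_powersetCard_univ]
  have hv : ∀ i : Fin (n + 1), valueSet (Fin.succAboveOrderEmb i) =
      ({i}ᶜ : Finset (Fin (n + 1))).map Fin.valEmbedding := fun i => by
    rw [valueSet, ← Finset.map_map]
    congr 1
    ext j
    simp only [Finset.mem_map, Finset.mem_univ, true_and, Finset.mem_compl, Finset.mem_singleton]
    exact Fin.exists_succAbove_eq_iff
  simp only [hv]
  refine Finset.sum_bij (fun i _ => ({i}ᶜ : Finset (Fin (n + 1)))) (fun i _ => ?_)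
    (fun i _ j _ h => by simpa using h) (fun T hT => ?_) fun _ _ => rfl
  · simp [Finset.mem_powersetCard, Finset.card_compl]
  · have h : Tᶜ.card = 1 := by
      rw [Finset.card_compl, Fintype.card_fin, (Finset.mem_powersetCard.1 hT).2]
      omega
    obtain ⟨i, hi⟩ := Finset.card_eq_one.1 h
    exact ⟨i, Finset.mem_univ _, by rw [← hi, compl_compl]⟩

/-- The letter `f 0` plays the role of the zero, and another letter counts as positive when it
exceeds `f 0`. Compatibility is then transitivity of the order, and with one zero the Gaussian
binomial is `1 + p + ⋯ + p^n`. -/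
theorem sum_wordMaj_insertZero {R : Type*} [CommRing R] (p : R) {n : ℕ} (f : Fin (n + 1) → ℤ)
    (hf : Function.Injective f) (τ : Equiv.Perm (Fin n)) :
    ∑ i : Fin (n + 1), p ^ wordMaj (f ∘ insertZero i τ) =
      p ^ wordMaj (f ∘ Fin.succ ∘ τ) * ∑ i ∈ Finset.range (n + 1), p ^ i := by
  set d : ℕ → Prop := WordDescent (f ∘ Fin.succ ∘ τ) with hd
  set s : ℕ → Prop := fun a => ∃ h : a < n, f 0 < f (τ ⟨a, h⟩).succ with hs
  have hsa : ∀ a : Fin n, s a ↔ f 0 < f (τ a).succ := fun a =>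
    ⟨fun ⟨_, h⟩ => h, fun h => ⟨a.2, h⟩⟩
  have hda : ∀ a b : Fin n, (b : ℕ) = a + 1 → (d a ↔ f (τ b).succ < f (τ a).succ) := by
    intro a b hab
    have hb : (a : ℕ) + 1 < n := hab ▸ b.2
    obtain rfl : b = ⟨a + 1, hb⟩ := Fin.ext hab
    exact ⟨fun ⟨_, h⟩ => h, fun h => ⟨hb, h⟩⟩
  have key : ∀ i : Fin (n + 1), wordMaj (f ∘ insertZero i τ) =
      shuffleMaj d s n (valueSet (Fin.succAboveOrderEmb i)) := by
    intro i
    have hi : ∀ j : Fin (n + 1), (∀ b, Fin.succAboveOrderEmb i b ≠ j) → j = i := by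
      intro j hj
      by_contra hne
      obtain ⟨b, hb⟩ := Fin.exists_succAbove_eq hne
      exact hj b hb
    refine wordMaj_eq_shuffleMaj (Fin.succAboveOrderEmb i) _ d s ?_ ?_ ?_ ?_
    · intro a b hab
      rw [hda a b hab]
      simp [insertZero_succAbove]
    · intro a j hj _
      rw [hi j hj, hsa]
      simp [insertZero_succAbove, insertZero_self]
    · intro a j hj _
      rw [hi j hj, hsa]
      have : f (τ a).succ ≠ f 0 := fun h => Fin.succ_ne_zero _ (hf h)
      simp only [Function.comp_apply, Fin.succAboveOrderEmb_apply, insertZero_succAbove,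
        insertZero_self]
      omega
    · intro j j' hj hj' hjj
      rw [hi j hj, hi j' hj'] at hjj
      omega
  simp only [key]
  rw [sum_powersetCard_succAbove (fun T => p ^ shuffleMaj d s n T)]
  have h := sum_shuffleMaj p (d := d) (s := s) (K := n) ?_ ?_ (n + 1)
  · rw [Nat.add_sub_cancel, gaussian_succ_self] at h
    exact h
  · intro a ha h1 h2
    have h1 := (hsa ⟨a, by omega⟩).1 h1
    have h2 := mt (hsa ⟨a + 1, ha⟩).2 h2
    exact (hda ⟨a, by omega⟩ ⟨a + 1, ha⟩ rfl).2 (by omega)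
  · intro a ha h1 h2 h3
    have h1 := mt (hsa ⟨a, by omega⟩).2 h1
    have h2 := (hsa ⟨a + 1, ha⟩).1 h2
    have h3 := (hda ⟨a, by omega⟩ ⟨a + 1, ha⟩ rfl).1 h3
    omega

/-- MacMahon's formula for the distribution of the major index on the rearrangements of a word
with distinct letters. -/
theorem sum_wordMaj_perm {R : Type*} [CommRing R] (p : R) {n : ℕ} (f : Fin n → ℤ)
    (hf : Function.Injective f) :
    ∑ σ : Equiv.Perm (Fin n), p ^ wordMaj (f ∘ σ) =
      ∏ m ∈ Finset.range n, ∑ i ∈ Finset.range (m + 1), p ^ i := by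
  induction n with
  | zero => simp [wordMaj, descentSum]
  | succ n ih =>
    -- Every rearrangement arises exactly once by inserting `f 0` into a rearrangement of the other
    -- letters.
    rw [← (Equiv.ofBijective _ (insertZero_bijective n)).sum_comp, Fintype.sum_prod_type_right,
      Finset.prod_range_succ, ← ih (f ∘ Fin.succ) (hf.comp (Fin.succ_injective n)),
      Finset.sum_mul]
    exact Finset.sum_congr rfl fun τ _ => sum_wordMaj_insertZero p f hf τ

/-! ### The distribution over all signed permutations -/

theorem letter_neg_iff {n : ℕ} (w : SignedPerm n) (i : Fin n) : letter w i < 0 ↔ w.2 i = -1 := by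
  rw [letter]
  rcases Int.units_eq_one_or (w.2 i) with h | h <;> rw [h]
  · have : ¬ ((1 : ℤˣ) = -1) := by decide
    simp only [Units.val_one, this, iff_false]
    omega
  · simp only [Units.val_neg, Units.val_one, iff_true]
    omega

theorem letter_eq_succ_iff {n : ℕ} (w : SignedPerm n) (i j : Fin n) :
    letter w i = (j : ℕ) + 1 ↔ w.2 i = 1 ∧ w.1 i = j := by
  rw [letter, Fin.ext_iff]
  rcases Int.units_eq_one_or (w.2 i) with h | h <;> rw [h]
  · simp
  · have : ¬ ((-1 : ℤˣ) = 1) := by decide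
    simp only [Units.val_neg, Units.val_one, this, false_and, iff_false]
    omega

theorem pow_neg_eq_prod {R : Type*} [CommRing R] (t : R) {n : ℕ} (w : SignedPerm n) :
    t ^ neg w = ∏ i, if w.2 i = -1 then t else 1 := by
  rw [neg, Finset.prod_ite, Finset.prod_const, Finset.prod_const_one, mul_one]
  simp only [letter_neg_iff]

/-- The letter `±(j + 1)` with sign `ε j`. -/
def signedValue {n : ℕ} (ε : Fin n → ℤˣ) (j : Fin n) : ℤ := (ε j : ℤ) * ((j : ℕ) + 1 : ℤ)

theorem signedValue_injective {n : ℕ} (ε : Fin n → ℤˣ) : Function.Injective (signedValue ε) := by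
  intro i j h
  have h' := congrArg Int.natAbs h
  simp only [signedValue, Int.natAbs_mul, Int.units_natAbs, one_mul] at h'
  exact Fin.ext (by omega)

/-- For a fixed choice of signs on the values, the words are the rearrangements of distinct letters,
and MacMahon's product does not depend on the signs. Summing `t ^ neg` over the signs gives `(1 +
t)^n`. -/
theorem sum_signedPerm {R : Type*} [CommRing R] (p t : R) (n : ℕ) :
    ∑ w : SignedPerm n, p ^ maj w * t ^ neg w =
      (1 + t) ^ n * ∏ m ∈ Finset.range n, ∑ i ∈ Finset.range (m + 1), p ^ i := by
  have h1 : ∀ σ : Equiv.Perm (Fin n),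
      ∑ ε : Fin n → ℤˣ, p ^ maj (σ, ε) * t ^ neg (σ, ε) =
        ∑ ε : Fin n → ℤˣ, p ^ wordMaj (signedValue ε ∘ σ) * ∏ i, if ε i = -1 then t else 1 := by
    intro σ
    -- The substitution `ε ↦ ε ∘ σ` turns signs indexed by positions into signs indexed by values.
    rw [← (Equiv.arrowCongr σ.symm (Equiv.refl ℤˣ)).sum_comp]
    refine Finset.sum_congr rfl fun ε _ => ?_
    rw [pow_neg_eq_prod, maj_eq_wordMaj, 
      ← Equiv.prod_comp σ fun j => if ε j = -1 then t else 1]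
    rfl
  have h2 : ∑ ε : Fin n → ℤˣ, ∏ i, (if ε i = -1 then t else 1) = (1 + t) ^ n := by
    have h := Finset.prod_univ_sum (fun _ : Fin n => (Finset.univ : Finset ℤˣ))
      (fun _ x => if x = -1 then t else 1)
    rw [Fintype.piFinset_univ] at h
    rw [← h, Finset.prod_const, Finset.card_univ, Fintype.card_fin, UnitsInt.univ,
      Finset.sum_pair (by decide), if_neg (by decide), if_pos rfl]
  rw [Fintype.sum_prod_type, Finset.sum_congr rfl fun σ _ => h1 σ, Finset.sum_comm, ← h2,
    Finset.sum_mul]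
  refine Finset.sum_congr rfl fun ε _ => ?_
  rw [← Finset.sum_mul, sum_wordMaj_perm p _ (signedValue_injective ε), mul_comm]

/-! ### Insertion of positive fixed points -/

section Inflate

variable {k n : ℕ} (e : Fin k ↪o Fin n)

/-- The signed permutation that has the pattern `v` on the range of `e`, and positive fixed points
elsewhere. -/
noncomputable def inflate (v : SignedPerm k) : SignedPerm n :=
  (v.1.viaFintypeEmbedding e.toEmbedding, Function.extend e v.2 1)

theorem inflate_fst_apply (v : SignedPerm k) (a : Fin k) : (inflate e v).1 (e a) = e (v.1 a) :=
  Equiv.Perm.viaFintypeEmbedding_apply_image v.1 e.toEmbedding a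

theorem inflate_snd_apply (v : SignedPerm k) (a : Fin k) : (inflate e v).2 (e a) = v.2 a :=
  e.injective.extend_apply _ _ _

theorem inflate_fst_of_notMem (v : SignedPerm k) {i : Fin n} (hi : ∀ b, e b ≠ i) :
    (inflate e v).1 i = i :=
  Equiv.Perm.viaFintypeEmbedding_apply_notMem_range v.1 e.toEmbedding (by simpa using hi)

theorem inflate_snd_of_notMem (v : SignedPerm k) {i : Fin n} (hi : ∀ b, e b ≠ i) :
    (inflate e v).2 i = 1 :=
  Function.extend_apply' _ _ _ (by simpa using hi)

theorem inflate_injective : Function.Injective (inflate e) := by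
  intro v v' h
  refine Prod.ext (Equiv.ext fun a => e.injective ?_) (funext fun a => ?_)
  · rw [← inflate_fst_apply, h, inflate_fst_apply]
  · rw [← inflate_snd_apply e, h, inflate_snd_apply]

theorem fixPos_inflate {v : SignedPerm k} (hv : fixPos v = ∅) :
    (fixPos (inflate e v))ᶜ = Finset.univ.map e.toEmbedding := by
  ext i
  simp only [fixPos, Finset.mem_compl, Finset.mem_filter, Finset.mem_univ, true_and,
    letter_eq_succ_iff, Finset.mem_map]
  constructor
  · intro h
    by_contra hi
    have hi : ∀ b, e b ≠ i := fun b hb => hi ⟨b, hb⟩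
    exact h ⟨inflate_snd_of_notMem e v hi, inflate_fst_of_notMem e v hi⟩
  · rintro ⟨a, rfl⟩ ⟨h1, h2⟩
    have h1 : v.2 a = 1 := by rw [← inflate_snd_apply e]; exact h1
    have h2 : v.1 a = a := e.injective (by rw [← inflate_fst_apply]; exact h2)
    have : a ∈ fixPos v :=
      Finset.mem_filter.2 ⟨Finset.mem_univ _, (letter_eq_succ_iff v a a).2 ⟨h1, h2⟩⟩
    rw [hv] at this
    exact absurd this (Finset.notMem_empty a)

theorem exists_inflate_eq {w : SignedPerm n}
    (hw : (fixPos w)ᶜ = Finset.univ.map e.toEmbedding) :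
    ∃ v : SignedPerm k, fixPos v = ∅ ∧ inflate e v = w := by
  have hfix : ∀ i, (∀ b, e b ≠ i) ↔ w.2 i = 1 ∧ w.1 i = i := by
    intro i
    have h := Finset.ext_iff.1 hw i
    simp only [fixPos, Finset.mem_compl, Finset.mem_filter, Finset.mem_univ, true_and,
      letter_eq_succ_iff, Finset.mem_map] at h
    rw [← not_iff_not, ← h.symm.trans Iff.rfl]
    simp [not_forall]
  -- A point off the range of `e` is its own image, so by injectivity it cannot be the image of a
  -- point of the range: `w` permutes the range.
  have hg : ∀ a, ∃ b, e b = w.1 (e a) := by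
    intro a
    by_contra hne
    have h1 := (hfix _).1 (not_exists.1 hne)
    have h2 : w.1 (e a) = e a := w.1.injective h1.2
    exact hne ⟨a, h2.symm⟩
  choose g hg using hg
  have hinj : Function.Injective g := fun a b h => by
    apply e.injective
    apply w.1.injective
    rw [← hg, ← hg, h]
  let v : SignedPerm k :=
    (Equiv.ofBijective g (Finite.injective_iff_bijective.1 hinj), w.2 ∘ e)
  refine ⟨v, ?_, ?_⟩
  · refine Finset.filter_eq_empty_iff.2 fun a _ h => ?_
    obtain ⟨h1, h2⟩ := (letter_eq_succ_iff v a a).1 h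
    have h2 : g a = a := h2
    exact (hfix (e a)).2 ⟨h1, by rw [← hg, h2]⟩ a rfl
  · refine Prod.ext (Equiv.ext fun i => ?_) (funext fun i => ?_)
    · by_cases hi : ∃ a, e a = i
      · obtain ⟨a, rfl⟩ := hi
        rw [inflate_fst_apply]
        exact hg a
      · rw [inflate_fst_of_notMem e v (not_exists.1 hi), ((hfix i).1 (not_exists.1 hi)).2]
    · by_cases hi : ∃ a, e a = i
      · obtain ⟨a, rfl⟩ := hi
        rw [inflate_snd_apply]
        rfl
      · rw [inflate_snd_of_notMem e v (not_exists.1 hi), ((hfix i).1 (not_exists.1 hi)).1]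

theorem neg_inflate (v : SignedPerm k) : neg (inflate e v) = neg v := by
  have h : Finset.univ.filter (fun i => letter (inflate e v) i < 0) =
      (Finset.univ.filter fun a => letter v a < 0).map e.toEmbedding := by
    ext i
    simp only [letter_neg_iff, Finset.mem_filter, Finset.mem_univ, true_and, Finset.mem_map]
    constructor
    · intro h
      by_cases hi : ∃ a, e a = i
      · obtain ⟨a, rfl⟩ := hi
        exact ⟨a, by rw [← inflate_snd_apply e, h], rfl⟩
      · rw [inflate_snd_of_notMem e v (not_exists.1 hi)] at h
        exact absurd h (by decide)
    · rintro ⟨a, h, rfl⟩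
      rw [← h]
      exact inflate_snd_apply e v a
  rw [neg, h, Finset.card_map, neg]

/-- The position `a` (counted from `0`) is an excedance of `v`. -/
def Excedance (v : SignedPerm k) (a : ℕ) : Prop := ∃ h : a < k, ((a : ℤ) + 1) < letter v ⟨a, h⟩

/-- The order of two signed letters depends only on their signs and on the order of their absolute
values, hence survives relabelling by a monotone map. -/
theorem mul_succ_lt_mul_succ_iff (ε ε' : ℤˣ) {x y x' y' : ℕ} (h : x < y ↔ x' < y')
    (h' : y < x ↔ y' < x') :
    (ε : ℤ) * (x + 1) < ε' * (y + 1) ↔ (ε : ℤ) * (x' + 1) < ε' * (y' + 1) := by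
  rcases Int.units_eq_one_or ε with rfl | rfl <;> rcases Int.units_eq_one_or ε' with rfl | rfl <;>
    simp only [Units.val_neg, Units.val_one] <;> omega

theorem letter_inflate_lt_iff (v : SignedPerm k) (a b : Fin k) :
    letter (inflate e v) (e a) < letter (inflate e v) (e b) ↔ letter v a < letter v b := by
  rw [letter, letter, inflate_fst_apply, inflate_fst_apply, inflate_snd_apply, inflate_snd_apply]
  exact mul_succ_lt_mul_succ_iff _ _ e.lt_iff_lt e.lt_iff_lt

theorem lt_letter_inflate_iff (v : SignedPerm k) (a : Fin k) :
    ((e a : ℕ) : ℤ) + 1 < letter (inflate e v) (e a) ↔ Excedance v a := by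
  have h := mul_succ_lt_mul_succ_iff 1 (v.2 a) (e.lt_iff_lt (a := a) (b := v.1 a))
    (e.lt_iff_lt (a := v.1 a) (b := a))
  simp only [Units.val_one, one_mul] at h
  rw [letter, inflate_fst_apply, inflate_snd_apply]
  refine Iff.trans ?_ (h.trans ⟨fun h => ⟨a.2, h⟩, fun ⟨_, h⟩ => h⟩)
  exact Iff.rfl

theorem letter_inflate_of_notMem (v : SignedPerm k) {i : Fin n} (hi : ∀ b, e b ≠ i) :
    letter (inflate e v) i = (i : ℕ) + 1 :=
  (letter_eq_succ_iff _ _ _).2 ⟨inflate_snd_of_notMem e v hi, inflate_fst_of_notMem e v hi⟩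

theorem letter_inflate_ne {v : SignedPerm k} (hv : fixPos v = ∅) (a : Fin k) :
    letter (inflate e v) (e a) ≠ ((e a : ℕ) : ℤ) + 1 := by
  intro h
  have h1 : e a ∈ (fixPos (inflate e v))ᶜ := by
    rw [fixPos_inflate e hv]
    exact Finset.mem_map_of_mem _ (Finset.mem_univ a)
  exact Finset.mem_compl.1 h1 (Finset.mem_filter.2 ⟨Finset.mem_univ _, h⟩)

theorem letter_inflate_ne_of_notMem (v : SignedPerm k) (a : Fin k) {i : Fin n}
    (hi : ∀ b, e b ≠ i) : letter (inflate e v) (e a) ≠ (i : ℕ) + 1 := by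
  intro h
  have := ((letter_eq_succ_iff _ _ _).1 h).2
  rw [inflate_fst_apply] at this
  exact hi _ this

theorem wordDescent_letter_iff (v : SignedPerm k) {a b : Fin k} (hab : (b : ℕ) = a + 1) :
    WordDescent (letter v) a ↔ letter v b < letter v a := by
  have hb : (a : ℕ) + 1 < k := hab ▸ b.2
  obtain rfl : b = ⟨a + 1, hb⟩ := Fin.ext hab
  exact ⟨fun ⟨_, h⟩ => h, fun h => ⟨hb, h⟩⟩

/-- A letter of the pattern equals neither its own position number, as `v` is a derangement, nor the
value of an inserted fixed point. Next to a fixed point it is therefore the larger of the two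
exactly when it is an excedance. Adjacent fixed points increase. -/
theorem maj_inflate {v : SignedPerm k} (hv : fixPos v = ∅) :
    maj (inflate e v) =
      shuffleMaj (WordDescent (letter v)) (Excedance v) (n - 1) (valueSet e) := by
  rw [maj_eq_wordMaj]
  refine wordMaj_eq_shuffleMaj e _ _ _ ?_ ?_ ?_ ?_
  · intro a b hab
    rw [letter_inflate_lt_iff, wordDescent_letter_iff v hab]
  · intro a i hi hia
    have h1 := letter_inflate_of_notMem e v hi
    have h2 := letter_inflate_ne_of_notMem e v a hi
    have h3 := letter_inflate_ne e hv a
    rw [← lt_letter_inflate_iff e]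
    omega
  · intro a i hi hia
    have h1 := letter_inflate_of_notMem e v hi
    have h2 := letter_inflate_ne_of_notMem e v a hi
    have h3 := letter_inflate_ne e hv a
    rw [← lt_letter_inflate_iff e]
    omega
  · intro i j hi hj hij
    rw [letter_inflate_of_notMem e v hi, letter_inflate_of_notMem e v hj]
    omega

end Inflate

theorem letter_ne_of_fixPos_eq_empty {k : ℕ} {v : SignedPerm k} (hv : fixPos v = ∅) (a : Fin k) :
    letter v a ≠ ((a : ℕ) : ℤ) + 1 :=
  Finset.filter_eq_empty_iff.1 hv (Finset.mem_univ a)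

/-- Compatibility holds for excedances: with positions counted from `1`, an excedance at `a`
followed by none at `a + 1` gives `x_a ≥ a + 1 > x_{a+1}`, while none at `a` followed by one at `a +
1` gives `x_a < x_{a+1}`. -/
theorem sum_shuffleMaj_derangement {R : Type*} [CommRing R] (p : R) {k : ℕ} {v : SignedPerm k}
    (hv : fixPos v = ∅) (n : ℕ) :
    ∑ T ∈ Finset.powersetCard k (Finset.range n),
        p ^ shuffleMaj (WordDescent (letter v)) (Excedance v) (n - 1) T =
      p ^ maj v * gaussian p n k := by
  rw [maj_eq_wordMaj]
  refine sum_shuffleMaj p ?_ ?_ n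
  · rintro a ha ⟨_, h1⟩ h2
    refine ⟨ha, ?_⟩
    have h2 : ¬ (((a + 1 : ℕ) : ℤ) + 1 < letter v ⟨a + 1, ha⟩) := fun h => h2 ⟨ha, h⟩
    have h3 := letter_ne_of_fixPos_eq_empty hv ⟨a + 1, ha⟩
    simp only at h3
    push_cast at h2 h3
    omega
  · rintro a ha h1 ⟨_, h2⟩ ⟨_, h3⟩
    have h1 : ¬ ((a : ℤ) + 1 < letter v ⟨a, by omega⟩) := fun h => h1 ⟨by omega, h⟩
    push_cast at h2
    omega

/-- The weighted count of the signed permutations with a given set of positions that are not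
positive fixed points. -/
theorem sum_fixPos_compl_eq {R : Type*} [CommRing R] (p t : R) {n k : ℕ} {T : Finset (Fin n)}
    (hT : T.card = k) :
    ∑ w : SignedPerm n with (fixPos w)ᶜ = T, p ^ maj w * t ^ neg w =
      ∑ v ∈ signedDerangements k,
        p ^ shuffleMaj (WordDescent (letter v)) (Excedance v) (n - 1) (T.map Fin.valEmbedding) *
          t ^ neg v := by
  have hmap : Finset.univ.map (T.orderEmbOfFin hT).toEmbedding = T := by
    apply Finset.coe_injective
    simp
  have hval : valueSet (T.orderEmbOfFin hT) = T.map Fin.valEmbedding := by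
    rw [valueSet, ← Finset.map_map, hmap]
  symm
  refine Finset.sum_bij (fun v _ => inflate (T.orderEmbOfFin hT) v) (fun v hv => ?_)
    (fun v _ v' _ h => inflate_injective _ h) (fun w hw => ?_) fun v hv => ?_
  · rw [Finset.mem_filter, fixPos_inflate _ (Finset.mem_filter.1 hv).2, hmap]
    exact ⟨Finset.mem_univ _, rfl⟩
  · obtain ⟨v, hv, h⟩ := exists_inflate_eq (T.orderEmbOfFin hT)
      ((Finset.mem_filter.1 hw).2.trans hmap.symm)
    exact ⟨v, Finset.mem_filter.2 ⟨Finset.mem_univ _, hv⟩, h⟩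
  · rw [maj_inflate _ (Finset.mem_filter.1 hv).2, neg_inflate, hval]

/-- Signed permutations are grouped by the set of positions that are not positive fixed points. For
each derangement of order `k`, summing over all such sets of size `k` produces the Gaussian
binomial. -/
theorem sum_signedPerm_eq_sum_gaussian {R : Type*} [CommRing R] (p t : R) (n : ℕ) :
    ∑ w : SignedPerm n, p ^ maj w * t ^ neg w =
      ∑ k ∈ Finset.range (n + 1),
        gaussian p n k * ∑ v ∈ signedDerangements k, p ^ maj v * t ^ neg v := by
  rw [← Finset.sum_fiberwise_of_maps_to (s := Finset.univ)
      (t := (Finset.univ : Finset (Fin n)).powerset) (g := fun w => (fixPos w)ᶜ) (by simp),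
    Finset.sum_powerset, Finset.card_univ, Fintype.card_fin]
  refine Finset.sum_congr rfl fun k _ => ?_
  rw [Finset.sum_congr rfl fun T hT => sum_fixPos_compl_eq p t (Finset.mem_powersetCard.1 hT).2,
    Finset.sum_comm, Finset.mul_sum]
  refine Finset.sum_congr rfl fun v hv => ?_
  rw [← Finset.sum_mul, sum_powersetCard_univ (fun T =>
      p ^ shuffleMaj (WordDescent (letter v)) (Excedance v) (n - 1) T),
    sum_shuffleMaj_derangement p (Finset.mem_filter.1 hv).2]
  ring

/-! ### The polynomials `D_n^B(q, Z)` -/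

theorem D_eq_sum (n : ℕ) :
    D n = ∑ v ∈ signedDerangements n, (q ^ 2) ^ maj v * (q * Z) ^ neg v := by
  have h : D n = MvPolynomial.coeToMvPowerSeries.ringHom (derangementPoly n) := rfl
  rw [h, derangementPoly, map_sum]
  refine Finset.sum_congr rfl fun v _ => ?_
  rw [map_mul, map_pow, map_pow, MvPolynomial.coeToMvPowerSeries.ringHom_apply,
    MvPolynomial.coeToMvPowerSeries.ringHom_apply, MvPolynomial.coe_X, MvPolynomial.coe_X, fmaj,
    pow_add, pow_mul, mul_pow, mul_assoc]
  rfl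

theorem qsqFactorial_eq (n : ℕ) : qsqFactorial n =
    (1 - q ^ 2) ^ n * ∏ m ∈ Finset.range n, ∑ i ∈ Finset.range (m + 1), (q ^ 2) ^ i := by
  have h : (1 - q ^ 2 : Coeff) ^ n = ∏ _m ∈ Finset.range n, (1 - q ^ 2) := by simp
  rw [qsqFactorial, qFactorial, h, ← Finset.prod_mul_distrib]
  refine Finset.prod_congr rfl fun m _ => ?_
  rw [mul_neg_geom_sum, pow_succ' _ m]

theorem qBinom_eq_gaussian {n k : ℕ} (h : k ≤ n) : qBinom (q ^ 2) n k = gaussian (q ^ 2) n k := by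
  rw [qBinom, quo_eq_iff ((isUnit_qFactorial k).mul (isUnit_qFactorial (n - k))),
    gaussian_mul_qFactorial _ h]

/-- Since `fmaj = 2 maj + neg`, the weight of a word is `(q²)^maj (qZ)^neg`, so the two evaluations
of the sum over all signed permutations are the two sides. -/
theorem binomialSum_D : BinomialSum D := by
  intro n
  have h := (sum_signedPerm (q ^ 2) (q * Z) n).symm.trans
    (sum_signedPerm_eq_sum_gaussian (q ^ 2) (q * Z) n)
  have hr : qsqFactorial n * ratio ^ n = (1 + q * Z) ^ n *
      ∏ m ∈ Finset.range n, ∑ i ∈ Finset.range (m + 1), (q ^ 2) ^ i := by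
    rw [qsqFactorial_eq, ← ratio_mul, mul_pow]
    ring
  rw [quo_factorial_mul_pow, hr, h]
  refine Finset.sum_congr rfl fun k hk => ?_
  rw [qBinom_eq_gaussian (Nat.lt_succ_iff.1 (Finset.mem_range.1 hk)), D_eq_sum]

end SignedDerangement

theorem mainTheorem5 :
    Multipliable (fun k : ℕ =>
      1 - SignedDerangement.u * SignedDerangement.const (SignedDerangement.q ^ 2) ^ k) ∧
    SignedDerangement.FactorialGenFun SignedDerangement.D ∧
    SignedDerangement.BinomialSum SignedDerangement.D ∧
    SignedDerangement.AlternatingSum SignedDerangement.D ∧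
    SignedDerangement.FirstRecurrence SignedDerangement.D ∧
    SignedDerangement.SecondRecurrence SignedDerangement.D ∧
    ∀ a : ℕ → SignedDerangement.Coeff, List.TFAE
      [SignedDerangement.FactorialGenFun a, SignedDerangement.BinomialSum a,
        SignedDerangement.AlternatingSum a, SignedDerangement.FirstRecurrence a,
        SignedDerangement.SecondRecurrence a] := by
  have h := SignedDerangement.tfae_forms SignedDerangement.D
  have hD := SignedDerangement.binomialSum_D
  exact ⟨SignedDerangement.hasProd_eulerSeries.multipliable, (h.out 1 0).1 hD, hD,
    (h.out 1 2).1 hD, (h.out 1 3).1 hD, (h.out 1 4).1 hD, SignedDerangement.tfae_forms⟩
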